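/- Let $E$ be a nonzero real Banach space with dual $E^*$ and bidual $E^{**}$, and for $x\in E$ let $\widehat x\in E^{**}$ be its canonical image. Write $\langle x,x^*\rangle = x^*(x)$ for $(x,x^*)\in E\times E^*$ and $\langle x^*,x^{**}\rangle = x^{**}(x^*)$ for $(x^*,x^{**})\in E^*\times E^{**}$. For a multifunction $S\colon E\rightrightarrows E^*$, let $G(S)=\{(s,s^*)\in E\times E^*: s^*\in S(s)\}$ be its graph and $R(S)=\bigcup_{x\in E}S(x)$ its range. $S$ is monotone if $\langle s-t,s^*-t^*\rangle\ge 0$ for all $(s,s^*),(t,t^*)\in G(S)$, and maximally monotone if it is monotone and $G(S)$ is not properly contained in the graph of another monotone multifunction. Infima are taken in $[-\infty,\infty]$. **Theorem.** Let $S\colon E\rightrightarrows E^*$ be maximally monotone. Then the following three conditions are equivalent. (a) $S$ is quasidense: for all $(x,x^*)\in E\times E^*$, $$\inf_{(s,s^*)\in G(S)}\Big[\tfrac12\|s-x\|^2+\tfrac12\|s^*-x^*\|^2+\langle s-x,s^*-x^*\rangle\Big]\le 0.$$ (b) $S$ is of type (FP) (locally maximally monotone): $S$ is monotone and, whenever $U$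 is a convex (norm-)open subset of $E^*$ with $U\cap R(S)\ne\emptyset$, $(w,w^*)\in E\times U$, and $\langle s-w,s^*-w^*\rangle\ge 0$ for all $(s,s^*)\in G(S)$ with $s^*\in U$, then $(w,w^*)\in G(S)$. (c) $S$ is of type (NI): for all $(w^*,w^{**})\in E^*\times E^{**}$, $$\inf_{(s,s^*)\in G(S)}\langle s^*-w^*,\widehat s-w^{**}\rangle\le 0.$$ -/

import Mathlib

namespace Multifunction

variable {E : Type*} [NormedAddCommGroup E] [NormedSpace ℝ E]

/-- The graph `G(S)` of a multifunction `S : E ⇉ E*`. -/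
def graph (S : E → Set (StrongDual ℝ E)) : Set (E × StrongDual ℝ E) :=
  {p | p.2 ∈ S p.1}

/-- The range `R(S)` of a multifunction `S : E ⇉ E*`. -/
def range (S : E → Set (StrongDual ℝ E)) : Set (StrongDual ℝ E) :=
  ⋃ x, S x

/-- `S` is monotone: `⟨s - t, s* - t*⟩ ≥ 0` for all `(s, s*), (t, t*) ∈ G(S)`. -/
def IsMonotone (S : E → Set (StrongDual ℝ E)) : Prop :=
  ∀ p ∈ graph S, ∀ q ∈ graph S, 0 ≤ (p.2 - q.2) (p.1 - q.1)

/-- `S` is maximally monotone: it is maximal among the monotone multifunctions, ordered by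
inclusion of graphs (the pointwise order on `E → Set E*`). -/
def IsMaximallyMonotone (S : E → Set (StrongDual ℝ E)) : Prop :=
  Maximal (fun T : E → Set (StrongDual ℝ E) => IsMonotone T) S

/-- `S` is quasidense: for all `(x, x*)`, the infimum over `(s, s*) ∈ G(S)` of
`½‖s - x‖² + ½‖s* - x*‖² + ⟨s - x, s* - x*⟩` is at most `0`.
The infimum is taken in the extended reals. -/
def IsQuasidense (S : E → Set (StrongDual ℝ E)) : Prop :=
  ∀ (x : E) (x' : StrongDual ℝ E),
    (⨅ p ∈ graph S,
      (((1 / 2 : ℝ) * ‖p.1 - x‖ ^ 2 + (1 / 2 : ℝ) * ‖p.2 - x'‖ ^ 2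
        + (p.2 - x') (p.1 - x) : ℝ) : EReal)) ≤ 0

/-- `S` is of type (FP), or locally maximally monotone. Openness is with respect to the
norm topology of `E*`. -/
def IsTypeFP (S : E → Set (StrongDual ℝ E)) : Prop :=
  IsMonotone S ∧
    ∀ U : Set (StrongDual ℝ E), Convex ℝ U → IsOpen U → (U ∩ range S).Nonempty →
      ∀ (w : E) (w' : StrongDual ℝ E), w' ∈ U →
        (∀ p ∈ graph S, p.2 ∈ U → 0 ≤ (p.2 - w') (p.1 - w)) →
        (w, w') ∈ graph S

/-- `S` is of type (NI): for all `(w*, w**) ∈ E* × E**`, the infimum over `(s, s*) ∈ G(S)` of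
`⟨s* - w*, ŝ - w**⟩` is at most `0`, where `ŝ` is the canonical image of `s` in the bidual.
The infimum is taken in the extended reals. -/
def IsTypeNI (S : E → Set (StrongDual ℝ E)) : Prop :=
  ∀ (w' : StrongDual ℝ E) (w'' : StrongDual ℝ (StrongDual ℝ E)),
    (⨅ p ∈ graph S,
      (((NormedSpace.inclusionInDoubleDual ℝ E p.1 - w'') (p.2 - w') : ℝ) : EReal)) ≤ 0

end Multifunction

open Set Metric Filter Topology
open scoped Pointwise

namespace Multifunction

variable {E : Type*} [NormedAddCommGroup E] [NormedSpace ℝ E]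

/-! Conditions (a) and (b) each give (c) by a well-chosen test point or open set. For the converse,
`exists_fitzpatrick_add_conjugate_le` separates the epigraph of the Fitzpatrick function from a
quadratic perturbation. A separating functional lives in `E* × E**`, where (NI) forbids it, so
approximate minimisers exist in `E × E*` itself. Translated by `w`, they lie in small enlargements
of the graph, and `exists_mem_graph_dist_le` moves them into the graph, using completeness. Taking
`V = E*` gives (a). A thin tube around the segment from `0` to `y' - w'` keeps the points inside `U`
and gives (b). -/

theorem biInf_coe_le_zero_iff {α : Type*} {G : Set α} {f : α → ℝ} :
    (⨅ p ∈ G, (f p : EReal)) ≤ 0 ↔ ∀ ε > 0, ∃ p ∈ G, f p < ε := by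
  constructor
  · intro h ε hε
    have h' : (⨅ p ∈ G, (f p : EReal)) < (ε : EReal) := h.trans_lt (by exact_mod_cast hε)
    simp only [iInf_lt_iff] at h'
    obtain ⟨p, hp, hlt⟩ := h'
    exact ⟨p, hp, by exact_mod_cast hlt⟩
  · intro h
    refine le_of_forall_gt fun c hc => ?_
    obtain ⟨ε, hε, hεc⟩ := EReal.lt_iff_exists_real_btwn.1 hc
    obtain ⟨p, hp, hlt⟩ := h ε (by exact_mod_cast hε)
    exact (iInf₂_le p hp).trans_lt (lt_trans (by exact_mod_cast hlt) hεc)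

theorem apply_le_norm_mul (f : StrongDual ℝ E) (x : E) : f x ≤ ‖f‖ * ‖x‖ :=
  (le_abs_self _).trans (f.le_opNorm x)

theorem neg_norm_mul_le_apply (f : StrongDual ℝ E) (x : E) : -(‖f‖ * ‖x‖) ≤ f x :=
  (abs_le.1 (f.le_opNorm x)).1

theorem IsMaximallyMonotone.mem_graph {S : E → Set (StrongDual ℝ E)} (hS : IsMaximallyMonotone S)
    {b : E × StrongDual ℝ E} (hb : ∀ p ∈ graph S, 0 ≤ (p.2 - b.2) (p.1 - b.1)) : b ∈ graph S := by
  have hT : IsMonotone (fun x => {x' | x' ∈ S x ∨ (x, x') = b}) := by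
    rintro p hp q hq
    rcases hp with hp | hp <;> rcases hq with hq | hq
    · exact hS.prop p hp q hq
    · obtain rfl : q = b := hq
      exact hb p hp
    · obtain rfl : p = b := hp
      have := hb q hq
      rwa [← neg_sub q.2, ← neg_sub q.1, neg_apply, map_neg, neg_neg]
    · obtain rfl : p = b := hp
      obtain rfl : q = p := hq
      simp
  exact hS.le_of_ge hT (fun x x' hx' => Or.inl hx') b.1 (Or.inr rfl)

theorem IsMaximallyMonotone.graph_nonempty {S : E → Set (StrongDual ℝ E)}
    (hS : IsMaximallyMonotone S) : (graph S).Nonempty := by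
  by_contra h
  rw [not_nonempty_iff_eq_empty] at h
  have : ((0, 0) : E × StrongDual ℝ E) ∈ graph S := hS.mem_graph (by simp [h])
  simp [h] at this

/-! ### Quasidensity and type (FP) each imply type (NI). -/

theorem exists_neg_half_sq_norm_le_apply (f : StrongDual ℝ E) {ε : ℝ} (hε : 0 < ε) :
    ∃ z : E, f z ≤ -(1 / 2 * ‖z‖ ^ 2) - 1 / 2 * ‖f‖ ^ 2 + ε := by
  rcases eq_or_ne f 0 with rfl | hf
  · exact ⟨0, by simpa using hε.le⟩
  have hf' : 0 < ‖f‖ := norm_pos_iff.2 hf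
  have hlt : ‖f‖ - ε / ‖f‖ < ‖f‖ := sub_lt_self _ (div_pos hε hf')
  obtain ⟨x, hx1, hx⟩ := f.exists_lt_apply_of_lt_opNorm hlt
  have key : ∃ y : E, ‖y‖ < 1 ∧ ‖f‖ - ε / ‖f‖ < f y := by
    rcases le_total 0 (f x) with h | h
    · exact ⟨x, hx1, by rwa [Real.norm_of_nonneg h] at hx⟩
    · exact ⟨-x, by simpa using hx1, by rwa [Real.norm_of_nonpos h, ← map_neg] at hx⟩
  obtain ⟨y, hy1, hy⟩ := key
  refine ⟨-(‖f‖ • y), ?_⟩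
  have h1 : ‖f‖ * (‖f‖ - ε / ‖f‖) ≤ ‖f‖ * f y := by gcongr
  have h2 : ‖f‖ * (‖f‖ - ε / ‖f‖) = ‖f‖ ^ 2 - ε := by field_simp
  have h3 : ‖-(‖f‖ • y)‖ ^ 2 ≤ ‖f‖ ^ 2 := by
    rw [norm_neg, norm_smul, norm_norm]
    gcongr
    nlinarith
  have h4 : f (-(‖f‖ • y)) = -(‖f‖ * f y) := by simp
  rw [h4]
  linarith

theorem IsQuasidense.isTypeNI {S : E → Set (StrongDual ℝ E)} (hS : IsQuasidense S) :
    IsTypeNI S := by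
  intro w' w''
  rw [biInf_coe_le_zero_iff]
  intro ε hε
  obtain ⟨z, hz⟩ := exists_neg_half_sq_norm_le_apply w'' (half_pos hε)
  -- The shift by `z` contributes `w'' z`, which cancels the squares arising from Young's inequality
  -- for `z p.1` and `w'' v`.
  obtain ⟨p, hp, hlt⟩ := biInf_coe_le_zero_iff.1 (hS 0 (w' - z)) (ε / 2) (half_pos hε)
  refine ⟨p, hp, ?_⟩
  set v := p.2 - (w' - z) with hv
  have hp2 : p.2 - w' = v - z := by rw [hv]; abel
  have e : (NormedSpace.inclusionInDoubleDual ℝ E p.1 - w'') (p.2 - w')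
      = v p.1 - z p.1 - w'' v + w'' z := by
    rw [hp2]; simp [NormedSpace.dual_def]; ring
  rw [e]
  simp only [sub_zero] at hlt
  have h1 := neg_norm_mul_le_apply z p.1
  have h2 := neg_norm_mul_le_apply w'' v
  nlinarith [sq_nonneg (‖z‖ - ‖p.1‖), sq_nonneg (‖w''‖ - ‖v‖)]

theorem IsTypeFP.isTypeNI {S : E → Set (StrongDual ℝ E)} (hS : IsTypeFP S)
    (hne : (graph S).Nonempty) : IsTypeNI S := by
  intro w' w''
  rw [biInf_coe_le_zero_iff]
  intro ε hε
  by_contra! hcon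
  obtain ⟨⟨y, y'⟩, hy⟩ := hne
  -- `ŵ` agrees with `w''` along the line `T` through `w'` and `y'`. In the tube of radius `ε / C`
  -- around `T`, replacing `w''` by `ŵ` then costs at most `ε`.
  obtain ⟨w, hw⟩ : ∃ w : E, (y' - w') w = w'' (y' - w') := by
    rcases eq_or_ne (y' - w') 0 with h | h
    · exact ⟨0, by simp [h]⟩
    · obtain ⟨v, hv⟩ := DFunLike.ne_iff.1 h
      have hv' : (y' - w') v ≠ 0 := hv
      refine ⟨(w'' (y' - w') / (y' - w') v) • v, ?_⟩
      rw [map_smul, smul_eq_mul, div_mul_cancel₀ _ hv']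
  set C := ‖w''‖ + ‖w‖ + 1 with hC
  have hCpos : 0 < C := by positivity
  set T : Set (StrongDual ℝ E) := Set.range fun t : ℝ => w' + t • (y' - w')
  have hTc : Convex ℝ T := by
    rintro _ ⟨s, rfl⟩ _ ⟨t, rfl⟩ a b _ _ hab
    refine ⟨a * s + b * t, ?_⟩
    obtain rfl : b = 1 - a := by linarith
    module
  have hmem : (w, w') ∈ graph S := by
    refine hS.2 (thickening (ε / C) T) (hTc.thickening _) isOpen_thickening
      ⟨y', ?_, mem_iUnion.2 ⟨y, hy⟩⟩ w w' ?_ ?_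
    · exact self_subset_thickening (by positivity) _ ⟨1, by simp⟩
    · exact self_subset_thickening (by positivity) _ ⟨0, by simp⟩
    · intro p hp hpU
      obtain ⟨_, ⟨t, rfl⟩, ht⟩ := mem_thickening_iff.1 hpU
      have h0 := hcon p hp
      set d := p.2 - (w' + t • (y' - w')) with hd
      rw [dist_eq_norm, ← hd] at ht
      have hp2 : p.2 - w' = d + t • (y' - w') := by rw [hd]; abel
      have e1 : (NormedSpace.inclusionInDoubleDual ℝ E p.1 - w'') (p.2 - w')
          = (p.2 - w') p.1 - w'' d - t * w'' (y' - w') := by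
        have : (NormedSpace.inclusionInDoubleDual ℝ E p.1 - w'') (p.2 - w')
          = (p.2 - w') p.1 - w'' (p.2 - w') := rfl
        rw [this]
        nth_rewrite 2 [hp2]
        rw [map_add, map_smul, smul_eq_mul]; ring
      have e2 : (p.2 - w') (p.1 - w) = (p.2 - w') p.1 - d w - t * (y' - w') w := by
        rw [map_sub]
        nth_rewrite 2 [hp2]
        rw [add_apply, smul_apply, smul_eq_mul]; ring
      rw [e1] at h0
      rw [e2, hw]
      have h1 := neg_norm_mul_le_apply w'' d
      have h2 := apply_le_norm_mul d w
      have h3 : ‖d‖ * C ≤ ε := by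
        rw [lt_div_iff₀ hCpos] at ht; exact ht.le
      rw [hC] at h3
      nlinarith [norm_nonneg d]
  have := hcon _ hmem
  simp at this
  linarith

/-! ### Weak-* separation and Fenchel duality. -/

/-- The closed thickening is `K` plus a closed ball, hence weak-* compact by Banach–Alaoglu, and
weak-* continuous functionals are evaluations at points of `E`. -/
theorem exists_separating_point_of_notMem_closure_thickening {K : Set (StrongDual ℝ E)}
    (hK : IsCompact K) (hKc : Convex ℝ K) {δ : ℝ} (hδ : 0 < δ) {a : StrongDual ℝ E}
    (ha : a ∉ closure (thickening δ K)) :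
    ∃ (x : E) (c : ℝ), (∀ z ∈ thickening δ K, z x ≤ c) ∧ c < a x := by
  set T : StrongDual ℝ E ≃ₗ[ℝ] WeakDual ℝ E := StrongDual.toWeakDual
  set W : Set (WeakDual ℝ E) := T '' K + T '' closedBall 0 δ with hW
  have hWT : W = T '' closure (thickening δ K) := by
    rw [closure_thickening hδ, ← hK.add_closedBall_zero hδ.le, hW, image_add]
  have hball : IsCompact (T '' closedBall 0 δ) := by
    have := WeakDual.isCompact_closedBall (𝕜 := ℝ) (0 : StrongDual ℝ E) δ
    rwa [← StrongDual.symm_toWeakDual, ← LinearEquiv.image_eq_preimage_symm] at this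
  have hWcompact : IsCompact W := (hK.image NormedSpace.Dual.toWeakDual_continuous).add hball
  have hWconv : Convex ℝ W :=
    (hKc.linear_image T.toLinearMap).add ((convex_closedBall _ _).linear_image T.toLinearMap)
  have haW : T a ∉ W := by
    rw [hWT]
    rintro ⟨b, hb, hba⟩
    exact ha (T.injective hba ▸ hb)
  have : LocallyConvexSpace ℝ (WeakDual ℝ E) :=
    inferInstanceAs (LocallyConvexSpace ℝ (WeakBilin (topDualPairing ℝ E)))
  obtain ⟨f, u, hf, hfa⟩ := geometric_hahn_banach_closed_point hWconv hWcompact.isClosed haW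
  obtain ⟨x, hx⟩ := LinearMap.dualEmbedding_surjective (topDualPairing ℝ E) f
  have hfx : ∀ z : StrongDual ℝ E, f (T z) = z x := fun z => by rw [← hx]; rfl
  refine ⟨x, u, fun z hz => ?_, hfx a ▸ hfa⟩
  rw [← hfx]
  exact (hf _ (hWT ▸ mem_image_of_mem T (subset_closure hz))).le

theorem sq_norm_combo_le {F : Type*} [SeminormedAddCommGroup F] [NormedSpace ℝ F] {x y : F}
    {a b : ℝ} (ha : 0 ≤ a) (hb : 0 ≤ b) (hab : a + b = 1) :
    ‖a • x + b • y‖ ^ 2 ≤ a * ‖x‖ ^ 2 + b * ‖y‖ ^ 2 := by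
  have h : ‖a • x + b • y‖ ≤ a * ‖x‖ + b * ‖y‖ := by
    simpa [norm_smul, abs_of_nonneg ha, abs_of_nonneg hb] using norm_add_le (a • x) (b • y)
  refine (pow_le_pow_left₀ (norm_nonneg _) h 2).trans ?_
  obtain rfl : b = 1 - a := by linarith
  nlinarith [mul_nonneg (mul_nonneg ha hb) (sq_nonneg (‖x‖ - ‖y‖))]

theorem neg_apply_sub_half_sq_le (z : StrongDual ℝ E) (x : E) :
    -(z x) - 1 / 2 * ‖z‖ ^ 2 ≤ 1 / 2 * ‖x‖ ^ 2 := by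
  nlinarith [neg_norm_mul_le_apply z x, sq_nonneg (‖z‖ - ‖x‖)]

/-- Fenchel duality for the Fitzpatrick function of a monotone set `G` of type (NI), perturbed by
`½‖·‖²` restricted to `V` and by its conjugate. The Fitzpatrick function enters through its
epigraph, and `hsep` says that the norm closure of `V` is weak-* closed. -/
theorem exists_fitzpatrick_add_conjugate_le {G : Set (E × StrongDual ℝ E)}
    (hmono : ∀ p ∈ G, ∀ q ∈ G, 0 ≤ (p.2 - q.2) (p.1 - q.1))
    (hNI : ∀ (w' : StrongDual ℝ E) (w'' : StrongDual ℝ (StrongDual ℝ E)), ∀ ε > 0,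
      ∃ p ∈ G, (NormedSpace.inclusionInDoubleDual ℝ E p.1 - w'') (p.2 - w') < ε)
    {V : Set (StrongDual ℝ E)} (hVo : IsOpen V) (hVc : Convex ℝ V)
    (hsep : ∀ a ∉ closure V, ∃ (x : E) (c : ℝ), (∀ z ∈ V, z x ≤ c) ∧ c < a x)
    {y : E × StrongDual ℝ E} (hy : y ∈ G) (hyV : y.2 ∈ V) {ε : ℝ} (hε : 0 < ε) :
    ∃ (x : E) (x' : StrongDual ℝ E) (t : ℝ), (∀ p ∈ G, p.2 x + x' p.1 - p.2 p.1 ≤ t) ∧ x' ∈ V ∧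
      ∀ z ∈ V, t + 1 / 2 * ‖x'‖ ^ 2 - z x - 1 / 2 * ‖z‖ ^ 2 ≤ ε := by
  set A : Set (E × StrongDual ℝ E × ℝ) :=
    {b | ∀ p ∈ G, p.2 b.1 + b.2.1 p.1 - p.2 p.1 ≤ b.2.2} with hA
  set D : Set (E × StrongDual ℝ E × ℝ) :=
    {b | b.2.1 ∈ V ∧ ∃ v, (∀ z ∈ V, -(z b.1) - 1 / 2 * ‖z‖ ^ 2 ≤ v) ∧
      b.2.2 + 1 / 2 * ‖b.2.1‖ ^ 2 + v ≤ ε} with hD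
  have hAc : Convex ℝ A := by
    rintro ⟨x, x', t⟩ h1 ⟨x₂, x₂', t₂⟩ h2 a b ha hb hab p hp
    have e1 := mul_le_mul_of_nonneg_left (h1 p hp) ha
    have e2 := mul_le_mul_of_nonneg_left (h2 p hp) hb
    obtain rfl : b = 1 - a := by linarith
    simp only [Prod.smul_mk, Prod.mk_add_mk, map_add, map_smul, add_apply,
      smul_apply, smul_eq_mul] at e1 e2 ⊢
    linarith
  have hDc : Convex ℝ D := by
    rintro ⟨x, x', t⟩ ⟨h1, v, hv, ht⟩ ⟨x₂, x₂', t₂⟩ ⟨h2, v₂, hv₂, ht₂⟩ a b ha hb hab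
    refine ⟨hVc h1 h2 ha hb hab, a * v + b * v₂, fun z hz => ?_, ?_⟩
    · have e1 := mul_le_mul_of_nonneg_left (hv z hz) ha
      have e2 := mul_le_mul_of_nonneg_left (hv₂ z hz) hb
      obtain rfl : b = 1 - a := by linarith
      simp only [Prod.smul_mk, Prod.mk_add_mk, map_add, map_smul, smul_eq_mul] at e1 e2 ⊢
      linarith
    · have e1 := mul_le_mul_of_nonneg_left ht ha
      have e2 := mul_le_mul_of_nonneg_left ht₂ hb
      have e3 := sq_norm_combo_le (x := x') (y := x₂') ha hb hab
      have e4 : a * ε + b * ε = ε := by rw [← add_mul, hab, one_mul]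
      simp only [Prod.smul_mk, Prod.mk_add_mk, smul_eq_mul] at e1 e2 ⊢
      linarith
  by_cases hdisj : Disjoint A D
  swap
  · obtain ⟨⟨x, x', t⟩, h1, h2, v, hv, ht⟩ := not_disjoint_iff.1 hdisj
    refine ⟨x, x', t, h1, h2, fun z hz => ?_⟩
    have := hv z hz
    dsimp only at this ht
    linarith
  exfalso
  -- Bounding the conjugate by `½‖x‖²` gives an open subset of `D`, so Hahn–Banach applies to its
  -- interior.
  set O : Set (E × StrongDual ℝ E × ℝ) :=
    {b | b.2.1 ∈ V} ∩ {b | b.2.2 + 1 / 2 * ‖b.2.1‖ ^ 2 + 1 / 2 * ‖b.1‖ ^ 2 < ε} with hO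
  have hOo : IsOpen O :=
    (hVo.preimage (by fun_prop)).inter (isOpen_lt (by fun_prop) continuous_const)
  have hOD : O ⊆ interior D := interior_maximal
    (fun b hb => ⟨hb.1, _, fun z _ => neg_apply_sub_half_sq_le z b.1, hb.2.le⟩) hOo
  obtain ⟨f, u, hfD, hfA⟩ := geometric_hahn_banach_open hDc.interior isOpen_interior hAc
    (hdisj.symm.mono_left interior_subset)
  set L : ℝ := 1 / 2 * ‖y.2‖ ^ 2 + 1 / 2 * ‖y.1‖ ^ 2 + 1 with hL
  have hyO : (y.1, y.2, -L) ∈ O := ⟨hyV, by simp only [hL, mem_ofPred_eq]; linarith⟩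
  have hGA : ∀ p ∈ G, (p.1, p.2, p.2 p.1) ∈ A := by
    intro p hp q hq
    have := hmono p hp q hq
    simp only [sub_apply, map_sub] at this
    dsimp only
    linarith
  set α := f (0, 0, 1) with hα
  have hf : ∀ x x' t, f (x, x', t) = f (x, 0, 0) + f (0, x', 0) + t * α := by
    intro x x' t
    rw [hα, ← smul_eq_mul, ← map_smul, ← map_add, ← map_add]
    simp
  have hαpos : 0 < α := by
    have h1 := hfD _ (hOD hyO)
    have h2 := hfA _ (hGA y hy)
    rw [hf] at h1 h2
    have h3 : 0 < y.2 y.1 + L := by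
      rw [hL]
      nlinarith [neg_norm_mul_le_apply y.2 y.1, sq_nonneg (‖y.2‖ - ‖y.1‖)]
    by_contra hα0
    nlinarith
  have hfD' : ∀ b ∈ D, f b ≤ u := by
    intro b hb
    refine closure_minimal (fun b hb => (hfD b hb).le) (isClosed_Iic.preimage f.continuous) ?_
    rw [hDc.closure_interior_eq_closure_of_nonempty_interior ⟨_, hOD hyO⟩]
    exact subset_closure hb
  set a' : StrongDual ℝ E :=
    α⁻¹ • f.comp (ContinuousLinearMap.inl ℝ E (StrongDual ℝ E × ℝ)) with ha'
  set a'' : StrongDual ℝ (StrongDual ℝ E) :=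
    α⁻¹ • (f.comp (ContinuousLinearMap.inr ℝ E (StrongDual ℝ E × ℝ))).comp
      (ContinuousLinearMap.inl ℝ (StrongDual ℝ E) ℝ) with ha''
  have hf' : ∀ x x' t, f (x, x', t) = α * (a' x + a'' x' + t) := by
    intro x x' t
    rw [hf]
    have e1 : a' x = α⁻¹ * f (x, 0, 0) := rfl
    have e2 : a'' x' = α⁻¹ * f (0, x', 0) := rfl
    rw [e1, e2]
    field_simp
  set c := u / α with hc
  have huc : u = α * c := by rw [hc]; field_simp
  have hGc : ∀ p ∈ G, c ≤ a' p.1 + a'' p.2 + p.2 p.1 := by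
    intro p hp
    have := hfA _ (hGA p hp)
    rw [hf', huc] at this
    exact le_of_mul_le_mul_left this hαpos
  have hDV : ∀ x v, (∀ z ∈ V, -(z x) - 1 / 2 * ‖z‖ ^ 2 ≤ v) → ∀ x' ∈ closure V,
      a' x + a'' x' + (ε - 1 / 2 * ‖x'‖ ^ 2 - v) ≤ c := by
    intro x v hv
    change closure V ⊆ {x' | a' x + a'' x' + (ε - 1 / 2 * ‖x'‖ ^ 2 - v) ≤ c}
    refine closure_minimal (fun x' hx' => ?_) (isClosed_le (by fun_prop) continuous_const)
    rw [mem_ofPred_eq]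
    have := hfD' (x, x', ε - 1 / 2 * ‖x'‖ ^ 2 - v) ⟨hx', v, hv, by dsimp only; linarith⟩
    rw [hf', huc] at this
    exact le_of_mul_le_mul_left this hαpos
  -- Otherwise, along `-n x₀` the conjugate grows at most like `n d`, while `a'` grows strictly
  -- faster, violating the upper bound `c`.
  have ha'V : -a' ∈ closure V := by
    by_contra hnot
    obtain ⟨x₀, d, hd, hda⟩ := hsep _ hnot
    rw [neg_apply] at hda
    have hgap : 0 < -(a' x₀) - d := by linarith
    obtain ⟨n, hn⟩ := exists_nat_gt ((c - (a'' y.2 + (ε - 1 / 2 * ‖y.2‖ ^ 2))) / (-(a' x₀) - d))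
    rw [div_lt_iff₀ hgap] at hn
    have := hDV (-((n : ℝ) • x₀)) (n * d) (fun z hz => ?_) y.2 (subset_closure hyV)
    · simp only [map_neg, map_smul, smul_eq_mul] at this
      linarith
    · have h1 := mul_le_mul_of_nonneg_left (hd z hz) (Nat.cast_nonneg (α := ℝ) n)
      simp only [map_neg, map_smul, smul_eq_mul, neg_neg]
      linarith [sq_nonneg ‖z‖]
  obtain ⟨z, hz⟩ := exists_neg_half_sq_norm_le_apply a' (ε := ε / 4) (by linarith)
  -- This gives `3ε/4 - a'' a' ≤ c`, whereas (NI) at `(-a', -a'')` gives `c < ε/4 - a'' a'`.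
  have h1 := hDV (-z) (1 / 2 * ‖-z‖ ^ 2) (fun z' _ => neg_apply_sub_half_sq_le z' (-z)) _ ha'V
  obtain ⟨p, hp, hlt⟩ := hNI (-a') (-a'') (ε / 4) (by linarith)
  have h2 := hGc p hp
  have e : (NormedSpace.inclusionInDoubleDual ℝ E p.1 - -a'') (p.2 - -a')
      = p.2 p.1 + a' p.1 + a'' p.2 + a'' a' := by
    rw [sub_neg_eq_add, sub_neg_eq_add, add_apply, map_add, map_add]
    simp only [NormedSpace.dual_def]
    ring
  rw [e] at hlt
  simp only [norm_neg, map_neg] at h1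
  linarith

/-! ### Enlargements and approximation by points of the graph. -/

/-- The `e`-enlargement of the graph of `S`. -/
def enlargement (S : E → Set (StrongDual ℝ E)) (e : ℝ) : Set (E × StrongDual ℝ E) :=
  {b | ∀ p ∈ graph S, -e ≤ (p.2 - b.2) (p.1 - b.1)}

theorem IsTypeNI.exists_mem_enlargement {S : E → Set (StrongDual ℝ E)} (hNI : IsTypeNI S)
    (hS : IsMonotone S) (w : E × StrongDual ℝ E)
    {V : Set (StrongDual ℝ E)} (hVo : IsOpen V) (hVc : Convex ℝ V)
    (hsep : ∀ a ∉ closure V, ∃ (x : E) (c : ℝ), (∀ z ∈ V, z x ≤ c) ∧ c < a x)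
    {y : E × StrongDual ℝ E} (hy : y ∈ graph S) (hyV : y.2 - w.2 ∈ V) {ε : ℝ} (hε : 0 < ε) :
    ∃ e, ∃ b ∈ enlargement S e, b.2 - w.2 ∈ V ∧ ∀ z ∈ V,
      e + (b.2 - w.2) (b.1 - w.1) + 1 / 2 * ‖b.2 - w.2‖ ^ 2 - z (b.1 - w.1) - 1 / 2 * ‖z‖ ^ 2
        ≤ ε := by
  obtain ⟨x, x', t, h1, h2, h3⟩ := exists_fitzpatrick_add_conjugate_le
    (G := {p | p + w ∈ graph S}) (V := V) (y := y - w)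
    (fun p hp q hq => by simpa using hS _ hp _ hq)
    (fun v' v'' η hη => by
      obtain ⟨p, hp, hlt⟩ := biInf_coe_le_zero_iff.1
        (hNI (v' + w.2) (v'' + NormedSpace.inclusionInDoubleDual ℝ E w.1)) η hη
      refine ⟨p - w, by simpa using hp, ?_⟩
      convert hlt using 2
      · simp only [Prod.fst_sub, map_sub]; abel
      · simp only [Prod.snd_sub]; abel)
    hVo hVc hsep (by simpa using hy) hyV hε
  refine ⟨t - x' x, (x, x') + w, fun p hp => ?_, by simpa using h2, fun z hz => ?_⟩
  · have := h1 (p - w) (by simpa using hp)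
    have e1 : p.2 - ((x, x') + w).2 = (p - w).2 - x' := by simp; abel
    have e2 : p.1 - ((x, x') + w).1 = (p - w).1 - x := by simp; abel
    rw [e1, e2]
    simp only [map_sub, sub_apply] at this ⊢
    linarith
  · have := h3 z hz
    simp only [Prod.fst_add, Prod.snd_add, add_sub_cancel_right]
    linarith

theorem IsTypeNI.exists_mem_enlargement_half_sq_norm {S : E → Set (StrongDual ℝ E)}
    (hNI : IsTypeNI S) (hS : IsMaximallyMonotone S) (w : E × StrongDual ℝ E) {ε : ℝ}
    (hε : 0 < ε) :
    ∃ e, ∃ b ∈ enlargement S e,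
      e + (b.2 - w.2) (b.1 - w.1) + 1 / 2 * ‖b.2 - w.2‖ ^ 2 + 1 / 2 * ‖b.1 - w.1‖ ^ 2 ≤ ε := by
  obtain ⟨y, hy⟩ := hS.graph_nonempty
  obtain ⟨e, b, hb, -, h⟩ := hNI.exists_mem_enlargement hS.prop w isOpen_univ convex_univ
    (by simp) hy (mem_univ _) hε
  refine ⟨e, b, hb, ?_⟩
  obtain ⟨g, hg, hgx⟩ := exists_dual_vector'' ℝ (b.1 - w.1)
  -- This `z` attains the supremum defining the conjugate of `½‖·‖²`.
  have h1 := h (-(‖b.1 - w.1‖ • g)) (mem_univ _)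
  have h2 : ‖-(‖b.1 - w.1‖ • g)‖ ^ 2 ≤ ‖b.1 - w.1‖ ^ 2 := by
    rw [norm_neg, norm_smul, norm_norm]
    gcongr
    exact mul_le_of_le_one_right (norm_nonneg _) hg
  rw [neg_apply, smul_apply, smul_eq_mul, hgx] at h1
  simp only [RCLike.ofReal_real_eq_id, id] at h1
  nlinarith

theorem IsMaximallyMonotone.nonneg_of_mem_enlargement {S : E → Set (StrongDual ℝ E)}
    (hS : IsMaximallyMonotone S) {e : ℝ} {b : E × StrongDual ℝ E} (hb : b ∈ enlargement S e) :
    0 ≤ e := by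
  by_contra! he
  have hmem : b ∈ graph S := hS.mem_graph fun p hp => by linarith [hb p hp]
  have := hb b hmem
  simp at this
  linarith

/-- The midpoint of `b` and `c` lies in an enlargement whose parameter involves the pairing of `c -
b`; by maximality that parameter is nonnegative. -/
theorem IsMaximallyMonotone.neg_two_mul_add_le {S : E → Set (StrongDual ℝ E)}
    (hS : IsMaximallyMonotone S) {e₁ e₂ : ℝ} {b c : E × StrongDual ℝ E}
    (hb : b ∈ enlargement S e₁) (hc : c ∈ enlargement S e₂) :
    -(2 * (e₁ + e₂)) ≤ (c.2 - b.2) (c.1 - b.1) := by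
  have hm : (1 / 2 : ℝ) • (b + c) ∈
      enlargement S (1 / 2 * (e₁ + e₂) + 1 / 4 * (c.2 - b.2) (c.1 - b.1)) := by
    intro p hp
    have h1 := hb p hp
    have h2 := hc p hp
    simp only [Prod.smul_fst, Prod.smul_snd, Prod.fst_add, Prod.snd_add, map_sub, map_add,
      sub_apply, add_apply, smul_apply, map_smul, smul_eq_mul] at h1 h2 ⊢
    linarith
  linarith [hS.nonneg_of_mem_enlargement hm]

/-- Minimising around `b` itself, the pairing of `c - b` is at least `-2(ε² + e)`, so both squared
norms are at most `5ε²`. -/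
theorem IsTypeNI.exists_dist_le {S : E → Set (StrongDual ℝ E)} (hNI : IsTypeNI S)
    (hS : IsMaximallyMonotone S) {ε : ℝ} (hε : 0 < ε) {b : E × StrongDual ℝ E}
    (hb : b ∈ enlargement S (ε ^ 2)) :
    ∃ c ∈ enlargement S ((ε / 2) ^ 2), dist b c ≤ 3 * ε := by
  obtain ⟨e, c, hc, h⟩ := hNI.exists_mem_enlargement_half_sq_norm hS b
    (ε := (ε / 2) ^ 2) (by positivity)
  have he := hS.nonneg_of_mem_enlargement hc
  have hr := neg_norm_mul_le_apply (c.2 - b.2) (c.1 - b.1)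
  have hq := hS.neg_two_mul_add_le hb hc
  have hee : e ≤ (ε / 2) ^ 2 := by
    nlinarith [sq_nonneg (‖c.2 - b.2‖ - ‖c.1 - b.1‖)]
  refine ⟨c, fun p hp => (neg_le_neg hee).trans (hc p hp), ?_⟩
  rw [dist_comm, dist_eq_norm]
  refine (Prod.norm_def _).trans_le (max_le ?_ ?_)
  · rw [Prod.fst_sub]
    refine abs_le_of_sq_le_sq' (a := ‖c.1 - b.1‖) (b := 3 * ε) ?_ (by positivity) |>.2
    nlinarith [sq_nonneg ‖c.2 - b.2‖]
  · rw [Prod.snd_sub]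
    refine abs_le_of_sq_le_sq' (a := ‖c.2 - b.2‖) (b := 3 * ε) ?_ (by positivity) |>.2
    nlinarith [sq_nonneg ‖c.1 - b.1‖]

/-- A Brøndsted–Rockafellar property of maximally monotone multifunctions of type (NI). -/
theorem IsTypeNI.exists_mem_graph_dist_le [CompleteSpace E] {S : E → Set (StrongDual ℝ E)}
    (hNI : IsTypeNI S) (hS : IsMaximallyMonotone S) {ε : ℝ} (hε : 0 < ε) {b : E × StrongDual ℝ E}
    (hb : b ∈ enlargement S (ε ^ 2)) : ∃ s ∈ graph S, dist b s ≤ 6 * ε := by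
  have step : ∀ (n : ℕ) (c : enlargement S ((ε / 2 ^ n) ^ 2)),
      ∃ d : enlargement S ((ε / 2 ^ (n + 1)) ^ 2), dist c.1 d.1 ≤ 6 * ε / 2 / 2 ^ n := by
    intro n c
    obtain ⟨d, hd, hcd⟩ := hNI.exists_dist_le hS (by positivity) c.2
    rw [div_div, ← pow_succ] at hd
    exact ⟨⟨d, hd⟩, hcd.trans_eq (by ring)⟩
  choose F hF using step
  let f : ∀ n : ℕ, enlargement S ((ε / 2 ^ n) ^ 2) := Nat.rec ⟨b, by simpa using hb⟩ F
  have hf : ∀ n, dist (f n).1 (f (n + 1)).1 ≤ 6 * ε / 2 / 2 ^ n := fun n => hF n (f n)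
  obtain ⟨s, hs⟩ := cauchySeq_tendsto_of_complete (cauchySeq_of_le_geometric_two hf)
  -- The steps sum to `3ε + 3ε/2 + ⋯ = 6ε`.
  refine ⟨s, hS.mem_graph fun p hp => ?_, dist_le_of_le_geometric_two_of_tendsto₀ hf hs⟩
  have hcont : Continuous fun c : E × StrongDual ℝ E => (p.2 - c.2) (p.1 - c.1) :=
    (continuous_const.sub continuous_snd).clm_apply (continuous_const.sub continuous_fst)
  have h0 : Tendsto (fun n : ℕ => -(ε / 2 ^ n) ^ 2) atTop (𝓝 0) := by
    have : Tendsto (fun n : ℕ => ε / 2 ^ n) atTop (𝓝 0) :=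
      tendsto_const_nhds.div_atTop (tendsto_pow_atTop_atTop_of_one_lt one_lt_two)
    simpa using (this.pow 2).neg
  exact le_of_tendsto_of_tendsto' h0 ((hcont.tendsto s).comp hs) fun n => (f n).2 p hp

/-! ### Type (NI) implies quasidensity and type (FP). -/

theorem IsMaximallyMonotone.isClosed_graph {S : E → Set (StrongDual ℝ E)}
    (hS : IsMaximallyMonotone S) : IsClosed (graph S) := by
  have : graph S = ⋂ p ∈ graph S, {b | 0 ≤ (p.2 - b.2) (p.1 - b.1)} := by
    ext b
    simp only [mem_iInter, mem_ofPred_eq]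
    exact ⟨fun hb p hp => hS.prop p hp b hb, hS.mem_graph⟩
  rw [this]
  exact isClosed_biInter fun p _ => isClosed_le continuous_const
    ((continuous_const.sub continuous_snd).clm_apply (continuous_const.sub continuous_fst))

theorem IsTypeNI.isQuasidense [CompleteSpace E] {S : E → Set (StrongDual ℝ E)}
    (hNI : IsTypeNI S) (hS : IsMaximallyMonotone S) : IsQuasidense S := by
  intro x x'
  rw [biInf_coe_le_zero_iff]
  intro ε hε
  obtain ⟨y, hy⟩ := hS.graph_nonempty
  set Y := y.1 - x with hY
  set Y' := y.2 - x' with hY'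
  -- `R` bounds `X` and `X'` by comparison with the fixed graph point `y`, independently of `η`.
  -- Moving from `b` to `s` then costs at most `η (4R + 3)` in total.
  set R := 2 * (‖Y‖ + ‖Y'‖) + 2 with hR
  have hRpos : 0 < R := by positivity
  set η := min 1 (ε / (2 * (4 * R + 3))) with hη
  have hηpos : 0 < η := lt_min one_pos (by positivity)
  have hη1 : η ≤ 1 := min_le_left _ _
  have hηε : η * (4 * R + 3) < ε := by
    have : η ≤ ε / (2 * (4 * R + 3)) := min_le_right _ _
    rw [le_div_iff₀ (by positivity)] at this
    linarith
  obtain ⟨e, b, hb, h⟩ := hNI.exists_mem_enlargement_half_sq_norm hS (x, x')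
    (ε := (η / 6) ^ 2) (by positivity)
  have he := hS.nonneg_of_mem_enlargement hb
  have hby := hb y hy
  set X := b.1 - x with hX
  set X' := b.2 - x' with hX'
  have e1 : y.1 - b.1 = Y - X := by rw [hY, hX]; abel
  have e2 : y.2 - b.2 = Y' - X' := by rw [hY', hX']; abel
  rw [e1, e2] at hby
  simp only [map_sub, sub_apply] at hby
  have hη2 : (η / 6) ^ 2 ≤ η ^ 2 := by nlinarith
  have hη3 : η ^ 2 ≤ η := by nlinarith
  have hbound : 1 / 2 * (‖X‖ - ‖Y'‖) ^ 2 + 1 / 2 * (‖X'‖ - ‖Y‖) ^ 2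
      ≤ 1 + 1 / 2 * (‖Y‖ + ‖Y'‖) ^ 2 := by
    nlinarith [apply_le_norm_mul Y' Y, neg_norm_mul_le_apply Y' X, neg_norm_mul_le_apply X' Y]
  have hXR : ‖X‖ ≤ R := by
    have : ‖X‖ - ‖Y'‖ ≤ ‖Y‖ + ‖Y'‖ + 2 :=
      (abs_le_of_sq_le_sq' (by nlinarith [norm_nonneg Y, norm_nonneg Y'])
        (by positivity)).2
    linarith [norm_nonneg Y]
  have hXR' : ‖X'‖ ≤ R := by
    have : ‖X'‖ - ‖Y‖ ≤ ‖Y‖ + ‖Y'‖ + 2 :=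
      (abs_le_of_sq_le_sq' (by nlinarith [norm_nonneg Y, norm_nonneg Y'])
        (by positivity)).2
    linarith [norm_nonneg Y']
  have hee : e ≤ (η / 6) ^ 2 := by
    nlinarith [neg_norm_mul_le_apply X' X, sq_nonneg (‖X‖ - ‖X'‖)]
  obtain ⟨s, hs, hbs⟩ := hNI.exists_mem_graph_dist_le hS (ε := η / 6) (by positivity)
    (b := b) (fun p hp => (neg_le_neg hee).trans (hb p hp))
  have hbs' : dist s b ≤ η := by rw [dist_comm]; linarith
  rw [dist_eq_norm] at hbs'
  set D := s.1 - b.1 with hD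
  set D' := s.2 - b.2 with hD'
  have hDη : ‖D‖ ≤ η := (norm_fst_le (s - b)).trans hbs'
  have hDη' : ‖D'‖ ≤ η := (norm_snd_le (s - b)).trans hbs'
  refine ⟨s, hs, ?_⟩
  have e3 : s.1 - x = X + D := by rw [hX, hD]; abel
  have e4 : s.2 - x' = X' + D' := by rw [hX', hD']; abel
  rw [e3, e4]
  have n1 : ‖X + D‖ ^ 2 ≤ (‖X‖ + η) ^ 2 := by
    gcongr; exact (norm_add_le _ _).trans (by gcongr)
  have n2 : ‖X' + D'‖ ^ 2 ≤ (‖X'‖ + η) ^ 2 := by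
    gcongr; exact (norm_add_le _ _).trans (by gcongr)
  have n3 : X' D ≤ R * η := (apply_le_norm_mul X' D).trans (by gcongr)
  have n4 : D' X ≤ η * R := (apply_le_norm_mul D' X).trans (by gcongr)
  have n5 : D' D ≤ η * η := (apply_le_norm_mul D' D).trans (by gcongr)
  have n6 : ‖X‖ * η ≤ R * η := by gcongr
  have n7 : ‖X'‖ * η ≤ R * η := by gcongr
  simp only [map_add, add_apply]
  linarith

theorem IsTypeNI.isTypeFP [CompleteSpace E] {S : E → Set (StrongDual ℝ E)}
    (hNI : IsTypeNI S) (hS : IsMaximallyMonotone S) : IsTypeFP S := by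
  refine ⟨hS.prop, fun U hUc hUo hUne w w' hw' hrel => ?_⟩
  obtain ⟨y', hy'U, hy'⟩ := hUne
  obtain ⟨y, hy⟩ := mem_iUnion.1 hy'
  set Y := y - w with hY
  set Y' := y' - w' with hY'
  set K := segment ℝ 0 Y' with hK
  have hKc : Convex ℝ K := convex_segment _ _
  have hKcompact : IsCompact K := by
    rw [hK, segment_eq_image]
    exact isCompact_Icc.image (by fun_prop)
  have hU₀o : IsOpen {z | z + w' ∈ U} := hUo.preimage (continuous_id.add continuous_const)
  have hU₀c : Convex ℝ {z | z + w' ∈ U} := hUc.translate_preimage_left w'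
  have hKU : K ⊆ {z | z + w' ∈ U} :=
    hU₀c.segment_subset (by simpa using hw') (by simpa [hY'] using hy'U)
  obtain ⟨δ₀, hδ₀, hthick⟩ := hKcompact.exists_thickening_subset_open hU₀o hKU
  -- Half the radius leaves room to perturb points of `V` by `D'` without leaving `U`.
  set δ := δ₀ / 2 with hδdef
  have hδ : 0 < δ := half_pos hδ₀
  set V := thickening δ K with hV
  have h0K : (0 : StrongDual ℝ E) ∈ K := left_mem_segment _ _ _
  have hY'K : Y' ∈ K := right_mem_segment _ _ _
  set M := ‖Y'‖ + δ with hM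
  have hVM : ∀ z ∈ V, ‖z‖ ≤ M := by
    intro z hz
    obtain ⟨k, hk, hzk⟩ := mem_thickening_iff.1 hz
    rw [hK, segment_eq_image] at hk
    obtain ⟨t, ⟨ht0, ht1⟩, rfl⟩ := hk
    simp only [smul_zero, zero_add] at hzk
    have : ‖t • Y'‖ ≤ ‖Y'‖ := by
      rw [norm_smul, Real.norm_of_nonneg ht0]
      exact mul_le_of_le_one_left (norm_nonneg _) ht1
    rw [dist_eq_norm] at hzk
    linarith [norm_le_norm_add_norm_sub' z (t • Y')]
  have hVball : ∀ k ∈ K, ∀ d : StrongDual ℝ E, ‖d‖ < δ → k + d ∈ V := fun k hk d hd =>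
    mem_thickening_iff.2 ⟨k, hk, by simpa [dist_eq_norm] using hd⟩
  have hVsub : ∀ z ∈ V, ∀ d : StrongDual ℝ E, ‖d‖ < δ → z + d + w' ∈ U := by
    intro z hz d hd
    refine hthick ?_
    obtain ⟨k, hk, hzk⟩ := mem_thickening_iff.1 hz
    refine mem_thickening_iff.2 ⟨k, hk, ?_⟩
    rw [dist_eq_norm] at hzk ⊢
    have : z + d - k = (z - k) + d := by abel
    rw [this]
    linarith [norm_add_le (z - k) d]
  have hMpos : 0 < M := by positivity
  set R := 2 / δ * (1 + ‖Y'‖ * ‖Y‖ + M * ‖Y‖ + 1 / 2 * M ^ 2) with hR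
  have hRpos : 0 < R := by positivity
  set B := M + R + 2 with hB
  have hBpos : 0 < B := by positivity
  -- The graph is closed, so graph points arbitrarily near `(w, w')` suffice.
  rw [← hS.isClosed_graph.closure_eq, Metric.mem_closure_iff]
  intro τ hτ
  set ρ := min τ δ / 2 with hρ
  have hρpos : 0 < ρ := half_pos (lt_min hτ hδ)
  have hρτ : ρ ≤ τ / 2 := by rw [hρ]; gcongr; exact min_le_left _ _
  have hρδ : ρ < δ := by linarith [min_le_right τ δ]
  set η := min 1 (min (ρ / 2) (ρ ^ 2 / (2 * B))) with hη
  have hηpos : 0 < η := lt_min one_pos (lt_min (by positivity) (by positivity))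
  have hη1 : η ≤ 1 := min_le_left _ _
  have hηρ : η ≤ ρ / 2 := (min_le_right _ _).trans (min_le_left _ _)
  have hηB : η * B ≤ 1 / 2 * ρ ^ 2 := by
    have : η ≤ ρ ^ 2 / (2 * B) := (min_le_right _ _).trans (min_le_right _ _)
    rw [le_div_iff₀ (by positivity)] at this
    linarith
  have hη2 : (η / 6) ^ 2 ≤ η ^ 2 := by nlinarith
  have hη3 : η ^ 2 ≤ η := by nlinarith
  obtain ⟨e, b, hb, hbV, h⟩ := hNI.exists_mem_enlargement hS.prop (w, w') (V := V)
    isOpen_thickening (hKc.thickening δ)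
    (fun a ha => exists_separating_point_of_notMem_closure_thickening hKcompact hKc hδ ha)
    (y := (y, y')) hy (self_subset_thickening hδ _ hY'K) (ε := (η / 6) ^ 2) (by positivity)
  have he := hS.nonneg_of_mem_enlargement hb
  have hby := hb (y, y') hy
  dsimp only at h hbV hby
  set X := b.1 - w with hX
  set X' := b.2 - w' with hX'
  have e1 : y - b.1 = Y - X := by rw [hY, hX]; abel
  have e2 : y' - b.2 = Y' - X' := by rw [hY', hX']; abel
  rw [e1, e2] at hby
  simp only [map_sub, sub_apply] at hby
  have hX'M := hVM _ hbV
  obtain ⟨g, hg, hgX⟩ := exists_dual_vector'' ℝ X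
  replace hgX : g X = ‖X‖ := hgX
  have hgn : ∀ r : ℝ, 0 ≤ r → ‖-(r • g)‖ ≤ r := by
    intro r hr
    rw [norm_neg, norm_smul, Real.norm_of_nonneg hr]
    exact mul_le_of_le_one_right hr hg
  have hXR : ‖X‖ ≤ R := by
    -- Tilting `Y'` against `X` inside `V` produces the term `δ/2 * ‖X‖`, and monotonicity against
    -- `y` bounds the rest.
    have hzV : Y' + -((δ / 2) • g) ∈ V :=
      hVball _ hY'K _ ((hgn _ (by positivity)).trans_lt (by linarith))
    have h1 := h _ hzV
    have h2 : ‖Y' + -((δ / 2) • g)‖ ^ 2 ≤ M ^ 2 := by gcongr; exact hVM _ hzV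
    have h3 : (Y' + -((δ / 2) • g)) X = Y' X - δ / 2 * ‖X‖ := by
      simp [hgX]; ring
    rw [h3] at h1
    have h4 := apply_le_norm_mul Y' Y
    have h5 : -(M * ‖Y‖) ≤ X' Y :=
      (neg_le_neg (by gcongr)).trans (neg_norm_mul_le_apply X' Y)
    have h6 : δ / 2 * ‖X‖ ≤ 1 + ‖Y'‖ * ‖Y‖ + M * ‖Y‖ + 1 / 2 * M ^ 2 := by
      linarith [sq_nonneg ‖X'‖]
    rw [hR]
    calc ‖X‖ = 2 / δ * (δ / 2 * ‖X‖) := by field_simp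
      _ ≤ _ := by gcongr
  have hee : e ≤ (η / 6) ^ 2 := by linarith [h _ hbV]
  obtain ⟨s, hs, hbs⟩ := hNI.exists_mem_graph_dist_le hS (ε := η / 6) (by positivity)
    (b := b) (fun p hp => (neg_le_neg hee).trans (hb p hp))
  have hbs' : dist s b ≤ η := by rw [dist_comm]; linarith
  rw [dist_eq_norm] at hbs'
  set D := s.1 - b.1 with hD
  set D' := s.2 - b.2 with hD'
  have hDη : ‖D‖ ≤ η := (norm_fst_le (s - b)).trans hbs'
  have hDη' : ‖D'‖ ≤ η := (norm_snd_le (s - b)).trans hbs'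
  have e3 : s.1 - w = X + D := by rw [hX, hD]; abel
  have e4 : s.2 - w' = X' + D' := by rw [hX', hD']; abel
  have hsU : s.2 ∈ U := by
    have := hVsub X' hbV D' (by linarith)
    rwa [← e4, sub_add_cancel] at this
  -- The hypothesis on `(w, w')` makes `X' X` nearly nonnegative. Testing the minimality with `z =
  -- 0` and `z = -ρ g` then bounds `X'` and `X`.
  have hq := hrel s hs hsU
  rw [e3, e4] at hq
  simp only [map_add, add_apply] at hq
  have n3 : X' D ≤ M * η := (apply_le_norm_mul X' D).trans (by gcongr)
  have n4 : D' X ≤ η * R := (apply_le_norm_mul D' X).trans (by gcongr)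
  have n5 : D' D ≤ η * η := (apply_le_norm_mul D' D).trans (by gcongr)
  have hXX : (η / 6) ^ 2 - X' X ≤ 1 / 2 * ρ ^ 2 := by
    have : η * B = η * M + η * R + 2 * η := by rw [hB]; ring
    linarith
  have hX'ρ : ‖X'‖ ≤ ρ := by
    have h1 := h 0 (self_subset_thickening hδ _ h0K)
    simp only [zero_apply, norm_zero] at h1
    refine (abs_le_of_sq_le_sq' ?_ hρpos.le).2
    linarith
  have hXρ : ‖X‖ ≤ ρ := by
    have h1 := h _ (hVball 0 h0K (-(ρ • g)) ((hgn ρ hρpos.le).trans_lt hρδ))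
    rw [zero_add] at h1
    have h2 : ‖-(ρ • g)‖ ^ 2 ≤ ρ ^ 2 := by gcongr; exact hgn ρ hρpos.le
    have h3 : (-(ρ • g)) X = -(ρ * ‖X‖) := by simp [hgX]
    rw [h3] at h1
    refine le_of_mul_le_mul_left (a := ρ) ?_ hρpos
    linarith [sq_nonneg ‖X'‖]
  refine ⟨s, hs, ?_⟩
  rw [dist_comm, dist_eq_norm]
  refine (Prod.norm_def _).trans_lt (max_lt ?_ ?_)
  · rw [Prod.fst_sub, e3]
    linarith [norm_add_le X D]
  · rw [Prod.snd_sub, e4]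
    linarith [norm_add_le X' D']

end Multifunction

theorem mainTheorem1 {E : Type*} [NormedAddCommGroup E] [NormedSpace ℝ E] [CompleteSpace E]
    [Nontrivial E] (S : E → Set (StrongDual ℝ E))
    (hS : Multifunction.IsMaximallyMonotone S) :
    List.TFAE [Multifunction.IsQuasidense S,
      Multifunction.IsTypeFP S,
      Multifunction.IsTypeNI S] := by
  tfae_have 1 → 3 := fun h => h.isTypeNI
  tfae_have 3 → 1 := fun h => h.isQuasidense hS
  tfae_have 2 → 3 := fun h => h.isTypeNI hS.graph_nonempty
  tfae_have 3 → 2 := fun h => h.isTypeFP hS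
  tfae_finish
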